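/- Let $G$ be a finite simple graph. A cover of $G$ is a pair $\mathcal{H}=(L,H)$, where $H$ is a finite simple graph and $L$ assigns to each vertex $v$ of $G$ a nonempty set $L(v)\subseteq V(H)$, such that the sets $L(v)$ are pairwise disjoint with union $V(H)$, every edge of $H$ joins $L(u)$ to $L(v)$ for some edge $uv$ of $G$, and for every edge $uv$ of $G$ the set $E_H(L(u),L(v))$ of edges of $H$ between $L(u)$ and $L(v)$ is a (possibly empty) matching. The cover is a full $m$-fold cover if $|L(v)|=m$ for every vertex $v$ of $G$ and $|E_H(L(u),L(v))|=m$ for every edge $uv$ of $G$. Let $P_{DP}(G,\mathcal{H})$ be the number of independent sets of $H$ that contain exactly one vertex of each $L(v)$, and for $m\ge 1$ let $P^*_{DP}(G,m)$ be the maximum of $P_{DP}(G,\mathcal{H})$ over all full $m$-fold covers $\mathcal{H}$ of $G$. Theorem. Let $n\ge 4$, $G=K_n$, $t=\binom{n}{2}$, and let $m$ be an integer with $m>2^{t+1}+t+n-6$. If $\mathcal{H}=(L,H)$ is a full $m$-fold cover of $G$ with $P_{DP}(G,\mathcal{H})=P^*_{DP}(G,m)$, then $H$ is triangle-free. Moreover,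 $$f(m)-2^t m^{n-4}\le P^*_{DP}(G,m)\le f(m)+2^t m^{n-4},$$ where $$f(m)=m^n-t\,m^{n-1}+\binom{t}{2}m^{n-2}-\left(\binom{t}{3}-\binom{n}{3}-3\binom{n}{4}\right)m^{n-3}.$$ -/

import Mathlib

namespace DPColoring

universe u

/-- The set `E_H(S, U)` of all edges of `H` with one endpoint in `S` and the other in `U`. -/
def edgesBetween {W : Type*} (H : SimpleGraph W) (S U : Set W) : Set (Sym2 W) :=
  {e | e ∈ H.edgeSet ∧ ∃ x ∈ S, ∃ y ∈ U, e = s(x, y)}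

/-- A set of edges is a matching if no two distinct edges of it share an endpoint. -/
def IsEdgeMatching {W : Type*} (M : Set (Sym2 W)) : Prop :=
  ∀ e ∈ M, ∀ f ∈ M, ∀ x : W, x ∈ e → x ∈ f → e = f

/-- A DP-cover `(L, H)` of the graph `G`, where the graph `H` has vertex set `W`. -/
structure DPCover {V : Type*} (G : SimpleGraph V) (W : Type*) where
  /-- the part assigned to each vertex of `G` -/
  L : V → Set W
  /-- the cover graph -/
  H : SimpleGraph W
  nonempty_part : ∀ v, (L v).Nonempty
  disjoint_parts : ∀ u v, u ≠ v → Disjoint (L u) (L v)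
  iUnion_parts : ⋃ v, L v = Set.univ
  matching : ∀ u v, G.Adj u v → IsEdgeMatching (edgesBetween H (L u) (L v))
  edges_eq : H.edgeSet = {e | ∃ u v, G.Adj u v ∧ e ∈ edgesBetween H (L u) (L v)}

namespace DPCover

variable {V W : Type*} {G : SimpleGraph V}

/-- A set of vertices of `H` containing exactly one vertex of every part. -/
def IsTransversal (C : DPCover G W) (T : Set W) : Prop :=
  ∀ v, ∃! x, x ∈ T ∧ x ∈ C.L v

/-- A proper coloring of `G` with respect to the cover: an independent transversal. -/
def IsColoring (C : DPCover G W) (T : Set W) : Prop :=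
  C.IsTransversal T ∧ C.H.IsIndepSet T

/-- `P_DP(G, (L, H))`: the number of proper colorings of `G` with respect to the cover. -/
noncomputable def numColorings (C : DPCover G W) : ℕ :=
  {T : Set W | C.IsColoring T}.ncard

/-- Every part has exactly `m` elements. -/
def IsFold (C : DPCover G W) (m : ℕ) : Prop :=
  ∀ v, (C.L v).ncard = m

/-- The cover is a full `m`-fold cover. -/
def IsFullFold (C : DPCover G W) (m : ℕ) : Prop :=
  C.IsFold m ∧ ∀ u v, G.Adj u v → (edgesBetween C.H (C.L u) (C.L v)).ncard = m

end DPCover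

/-- The values `P_DP(G, (L, H))` over all full `m`-fold covers `(L, H)` of `G` with `H` finite. -/
def fullFoldValues {V : Type u} (G : SimpleGraph V) (m : ℕ) : Set ℕ :=
  {k | ∃ (W : Type u) (_ : Finite W) (C : DPCover G W), C.IsFullFold m ∧ C.numColorings = k}

/-- The dual DP color function `P*_DP(G, m)`. -/
noncomputable def dualDPColorFunction {V : Type u} (G : SimpleGraph V) (m : ℕ) : ℕ :=
  sSup (fullFoldValues G m)

/-- The cover with a canonical labeling: `m` disjoint copies of `G`. -/
def canonicalCover {V : Type*} (G : SimpleGraph V) (m : ℕ) (hm : 0 < m) :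
    DPCover G (V × Fin m) where
  L v := {p | p.1 = v}
  H :=
    { Adj := fun p q => G.Adj p.1 q.1 ∧ p.2 = q.2
      symm := ⟨fun _ _ h => ⟨h.1.symm, h.2.symm⟩⟩
      loopless := ⟨fun _ h => G.loopless.irrefl _ h.1⟩ }
  nonempty_part v := ⟨(v, ⟨0, hm⟩), rfl⟩
  disjoint_parts u v huv := by
    rw [Set.disjoint_left]
    rintro p rfl h
    exact huv h
  iUnion_parts := by ext p; simp
  matching u v huv := by
    rintro e ⟨he, ⟨a, i⟩, rfl, ⟨b, j⟩, rfl, rfl⟩ f ⟨hf, ⟨c, k⟩, hc, ⟨d, l⟩, hd, rfl⟩ x hx hx'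
    simp only [Set.mem_ofPred_eq] at hc hd
    subst hc hd
    have hne := huv.ne
    simp only [SimpleGraph.mem_edgeSet] at he hf
    obtain ⟨-, rfl⟩ := he
    obtain ⟨-, rfl⟩ := hf
    simp only [Sym2.mem_iff] at hx hx'
    rcases hx with rfl | rfl <;> rcases hx' with h | h <;> simp_all
  edges_eq := by
    ext e
    induction e using Sym2.ind with
    | _ p q =>
      constructor
      · intro h
        exact ⟨p.1, q.1, h.1, h, p, rfl, q, rfl, rfl⟩
      · rintro ⟨u, v, -, h, -⟩
        exact h

theorem canonicalCover_isFullFold {V : Type*} (G : SimpleGraph V) (m : ℕ) (hm : 0 < m) :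
    (canonicalCover G m hm).IsFullFold m := by
  constructor
  · intro v
    have : (canonicalCover G m hm).L v = Set.range (fun i : Fin m => (v, i)) := by
      ext ⟨a, i⟩
      simp [canonicalCover, eq_comm]
    rw [this, ← Set.image_univ, Set.ncard_image_of_injective _ (fun i j h => by simpa using h)]
    simp [Set.ncard_univ]
  · intro u v huv
    have : edgesBetween (canonicalCover G m hm).H ((canonicalCover G m hm).L u)
        ((canonicalCover G m hm).L v) = Set.range (fun i : Fin m => s((u, i), (v, i))) := by
      ext e
      constructor
      · rintro ⟨he, ⟨a, i⟩, rfl, ⟨b, j⟩, rfl, rfl⟩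
        obtain ⟨-, rfl⟩ := (SimpleGraph.mem_edgeSet _).1 he
        exact ⟨i, rfl⟩
      · rintro ⟨i, rfl⟩
        exact ⟨⟨huv, rfl⟩, (u, i), rfl, (v, i), rfl, rfl⟩
    rw [this, ← Set.image_univ, Set.ncard_image_of_injective]
    · simp [Set.ncard_univ]
    · intro i j h
      have hne := huv.ne
      simpa [hne] using h

/-- For a finite graph and `m ≥ 1` the dual DP color function is a genuine maximum. -/
theorem isGreatest_dualDPColorFunction {V : Type u} [Finite V] (G : SimpleGraph V) (m : ℕ)
    (hm : 0 < m) : IsGreatest (fullFoldValues G m) (dualDPColorFunction G m) := by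
  have hne : (fullFoldValues G m).Nonempty :=
    ⟨_, V × Fin m, inferInstance, canonicalCover G m hm, canonicalCover_isFullFold G m hm, rfl⟩
  have hb : BddAbove (fullFoldValues G m) := by
    refine ⟨2 ^ (Nat.card V * m), ?_⟩
    rintro k ⟨W, hW, C, hC, rfl⟩
    have := Fintype.ofFinite V
    have hcard : Nat.card W ≤ Nat.card V * m := by
      rw [← Set.ncard_univ, ← C.iUnion_parts]
      refine (Set.ncard_iUnion_le_of_fintype _).trans ?_
      simp [hC.1 _]
    calc C.numColorings ≤ (Set.univ : Set (Set W)).ncard :=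
          Set.ncard_le_ncard (Set.subset_univ _) Set.finite_univ
      _ = 2 ^ Nat.card W := by
          have := Fintype.ofFinite W
          classical
          simp [Set.ncard_univ]
      _ ≤ _ := Nat.pow_le_pow_right (by norm_num) hcard
  exact ⟨Nat.sSup_mem hne hb, fun k hk => le_csSup hb hk⟩

/-- `f(m) = m^n - t m^(n-1) + C(t,2) m^(n-2) - (C(t,3) - C(n,3) - 3 C(n,4)) m^(n-3)`, with
`t = C(n,2)`. -/
def mainPart (n m : ℕ) : ℤ :=
  (m : ℤ) ^ n - (n.choose 2 : ℤ) * (m : ℤ) ^ (n - 1)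
    + ((n.choose 2).choose 2 : ℤ) * (m : ℤ) ^ (n - 2)
    - (((n.choose 2).choose 3 : ℤ) - (n.choose 3 : ℤ) - 3 * (n.choose 4 : ℤ)) * (m : ℤ) ^ (n - 3)

end DPColoring

/-! Labeling the parts turns the cover into a graph `K` on `V × α`, with |α| = m, having a perfect
matching between any two parts. Colorings become the maps x : V → α for which no edge of K_n lifts
to `K`. Inclusion-exclusion over edge sets A gives P = ∑ (-1)^|A| |`lifts K A`|.

An edge with an endpoint not met by the other edges divides the number of lifts by m. Hence a forest
with at most four edges has m^(n-|A|) lifts in every cover, and a triangle-free set of at least four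
edges, not a 4-cycle, has at most m^(n-4). So the cover matters only through triangles, 4-cycles and
terms controlled by them: f(m) is the sum in which triangles contribute 0, 4-cycles their maximum
m^(n-3), and all other sets of four or more edges are dropped.

Upper bound: triangles enter with a minus sign, and a set properly containing one has at most 1/m
times its lifts. Let T be the total number of triangle lifts. There are 2^(t-1) even edge sets, so
2mP ≤ 2m f(m) + 2^t (m^(n-3) + T) - 2mT. For m ≥ 2^t the terms in T are harmless. A triangle in H
has at least m^(n-3) lifts, and for m > 2^(t+1) this forces P < f(m) - 2^t m^(n-4), below the lower
bound, so such a cover is not optimal.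

Lower bound: match all parts along one fixed-point-free permutation that is an involution off at
most three labels. Triangles then have no lifts, and a 4-cycle falls short of m^(n-3) by at most
3m^(n-4). -/

open Finset

/-! ### Small triangle-free edge sets and their leaves -/

section EdgeSets

variable {V : Type*} [DecidableEq V]

/-- The edge set of the triangle `a b c`. -/
def triangleEdges (a b c : V) : Finset (Sym2 V) := {s(a, b), s(b, c), s(c, a)}

/-- The edge set of the 4-cycle `a b c d`. -/
def squareEdges (a b c d : V) : Finset (Sym2 V) := {s(a, b), s(b, c), s(c, d), s(d, a)}

/-- A set of edges is a triangle. -/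
def IsTriangle (A : Finset (Sym2 V)) : Prop :=
  ∃ a b c, a ≠ b ∧ b ≠ c ∧ c ≠ a ∧ A = triangleEdges a b c

/-- A set of edges is a 4-cycle. -/
def IsSquare4 (A : Finset (Sym2 V)) : Prop :=
  ∃ a b c d, a ≠ b ∧ a ≠ c ∧ a ≠ d ∧ b ≠ c ∧ b ≠ d ∧ c ≠ d ∧ A = squareEdges a b c d

/-- A set of edges contains no triangle. -/
def TriangleFree (A : Finset (Sym2 V)) : Prop := ∀ B, IsTriangle B → ¬ B ⊆ A

theorem TriangleFree.mono {A B : Finset (Sym2 V)} (hB : TriangleFree B) (h : A ⊆ B) :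
    TriangleFree A := fun T hT hTA => hB T hT (hTA.trans h)

theorem IsTriangle.card_eq {A : Finset (Sym2 V)} (h : IsTriangle A) : #A = 3 := by
  obtain ⟨a, b, c, hab, hbc, hca, rfl⟩ := h
  rw [triangleEdges, card_eq_three]
  refine ⟨_, _, _, ?_, ?_, ?_, rfl⟩ <;> simp <;> grind

theorem IsSquare4.card_eq {A : Finset (Sym2 V)} (h : IsSquare4 A) : #A = 4 := by
  obtain ⟨a, b, c, d, hab, hac, had, hbc, hbd, hcd, rfl⟩ := h
  rw [squareEdges, card_insert_of_notMem, card_eq_three.2]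
  · refine ⟨_, _, _, ?_, ?_, ?_, rfl⟩ <;> simp <;> grind
  · simp; grind

theorem IsSquare4.triangleFree {A : Finset (Sym2 V)} (h : IsSquare4 A) : TriangleFree A := by
  obtain ⟨a, b, c, d, hab, hac, had, hbc, hbd, hcd, rfl⟩ := h
  rintro T ⟨p, q, r, hpq, hqr, hrp, rfl⟩ hT
  have h1 : s(p, q) ∈ squareEdges a b c d := hT (by simp [triangleEdges])
  have h2 : s(q, r) ∈ squareEdges a b c d := hT (by simp [triangleEdges])
  have h3 : s(r, p) ∈ squareEdges a b c d := hT (by simp [triangleEdges])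
  simp only [squareEdges, mem_insert, mem_singleton, Sym2.eq_iff] at h1 h2 h3
  grind

/-- A nonempty triangle-free set of at most four edges other than a 4-cycle has a leaf `v`. -/
theorem exists_leaf {A : Finset (Sym2 V)} (hne : A.Nonempty) (hd : ∀ e ∈ A, ¬ e.IsDiag)
    (hA : #A ≤ 4) (ht : TriangleFree A) (hs : ¬ IsSquare4 A) :
    ∃ u v, u ≠ v ∧ s(u, v) ∈ A ∧ ∀ e ∈ A, v ∈ e → e = s(u, v) := by
  -- Without a leaf, a walk can always be continued without backtracking. Triangles being excluded,
  -- it either closes up into a 4-cycle or uses five distinct edges.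
  by_contra! hcon
  have next : ∀ u v, s(u, v) ∈ A → ∃ w, w ≠ u ∧ w ≠ v ∧ s(v, w) ∈ A := by
    intro u v huv
    obtain ⟨e, he, hve, hne⟩ := hcon u v (by simpa using hd _ huv) huv
    obtain ⟨w, rfl⟩ := hve
    refine ⟨w, ?_, ?_, he⟩
    · rintro rfl; exact hne Sym2.eq_swap
    · rintro rfl; exact hd _ he (by simp)
  have tri : ∀ a b c, a ≠ b → b ≠ c → c ≠ a → s(a, b) ∈ A → s(b, c) ∈ A → s(c, a) ∈ A → False := by
    intro a b c hab hbc hca h1 h2 h3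
    refine ht _ ⟨a, b, c, hab, hbc, hca, rfl⟩ ?_
    simp [triangleEdges, insert_subset_iff, h1, h2, h3]
  obtain ⟨e, he⟩ := hne
  induction e using Sym2.ind with
  | _ a b =>
  have hab : a ≠ b := by simpa using hd _ he
  obtain ⟨c, hca, hcb, h2⟩ := next a b he
  obtain ⟨d, hdb, hdc, h3⟩ := next b c h2
  have hda : d ≠ a := by
    rintro rfl
    exact tri _ _ _ hab hcb.symm hca he h2 h3
  obtain ⟨f, hfc, hfd, h4⟩ := next c d h3
  have hfb : f ≠ b := by
    rintro rfl
    exact tri f c d hfc hdc.symm hfd.symm h2 h3 h4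
  by_cases hfa : f = a
  · subst hfa
    refine hs ⟨f, b, c, d, hab, hca.symm, hda.symm, hcb.symm, hdb.symm, hdc.symm, ?_⟩
    have hsub : squareEdges f b c d ⊆ A := by
      simp [squareEdges, insert_subset_iff, he, h2, h3, h4]
    refine (eq_of_subset_of_card_le hsub ?_).symm
    rwa [IsSquare4.card_eq
      ⟨f, b, c, d, hab, hca.symm, hda.symm, hcb.symm, hdb.symm, hdc.symm, rfl⟩]
  · obtain ⟨g, hgd, hgf, h5⟩ := next d f h4
    have hsub : ({s(a, b), s(b, c), s(c, d), s(d, f), s(f, g)} : Finset (Sym2 V)) ⊆ A := by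
      simp [insert_subset_iff, he, h2, h3, h4, h5]
    have := card_le_card hsub
    rw [card_insert_of_notMem (by simp; grind), card_insert_of_notMem (by simp; grind),
      card_insert_of_notMem (by simp; grind), card_insert_of_notMem (by simp; grind)] at this
    simp at this
    omega

end EdgeSets

/-! ### Counting lifts of an edge set -/

section Solutions

variable {V α : Type*} [Fintype V] [DecidableEq V] [Fintype α]

open Classical in
/-- The labelings `x` of the vertices for which every edge of `A` lifts to an edge of `K`. -/
noncomputable def lifts (K : SimpleGraph (V × α)) (A : Finset (Sym2 V)) : Finset (V → α) :=
  {x | ∀ e ∈ A, e.map (fun v => (v, x v)) ∈ K.edgeSet}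

/-- Any two distinct parts of `K` are joined by a perfect matching. -/
def PerfectlyMatched (K : SimpleGraph (V × α)) : Prop :=
  ∀ u v, u ≠ v → ∀ i, ∃! j, K.Adj (u, i) (v, j)

variable {K : SimpleGraph (V × α)}

theorem mem_lifts {A : Finset (Sym2 V)} {x : V → α} :
    x ∈ lifts K A ↔ ∀ e ∈ A, e.map (fun v => (v, x v)) ∈ K.edgeSet := by
  simp [lifts]

theorem lifts_anti {A B : Finset (Sym2 V)} (h : A ⊆ B) : lifts K B ⊆ lifts K A := by
  intro x hx
  rw [mem_lifts] at hx ⊢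
  exact fun e he => hx e (h he)

theorem card_lifts_empty : #(lifts K (∅ : Finset (Sym2 V))) = Fintype.card α ^ Fintype.card V := by
  rw [← Fintype.card_fun, ← card_univ]
  congr 1
  ext x
  simp [mem_lifts]

-- The matching makes the label at `v` a function of the label at `u`, while membership in `X`
-- leaves the label at `v` free. Thus exactly one in m labelings survives.
open Classical in
omit [Fintype V] in
theorem card_filter_adj_mul (hK : PerfectlyMatched K) (X : Finset (V → α)) {u v : V} (huv : u ≠ v)
    (hX : ∀ x ∈ X, ∀ i, Function.update x v i ∈ X) :
    #{x ∈ X | K.Adj (u, x u) (v, x v)} * Fintype.card α = #X := by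
  choose f hf hu using hK u v huv
  rw [← card_univ (α := α), ← card_product]
  refine card_nbij' (fun p => Function.update p.1 v p.2)
    (fun x => (Function.update x v (f (x u)), x v)) ?_ ?_ ?_ ?_
  · rintro ⟨x, i⟩ hx
    simp only [coe_product, Set.mem_prod, mem_coe, mem_filter] at hx
    exact hX x hx.1.1 i
  · intro x hx
    simp only [coe_product, Set.mem_prod, mem_coe, mem_filter]
    refine ⟨⟨hX x hx _, ?_⟩, mem_univ _⟩
    simpa [huv] using hf (x u)
  · rintro ⟨x, i⟩ hx
    simp only [coe_product, Set.mem_prod, mem_coe, mem_filter] at hx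
    have := hu _ _ hx.1.2
    simp [huv, ← this]
  · intro x hx
    simp

theorem card_lifts_insert_mul (hK : PerfectlyMatched K) {A : Finset (Sym2 V)} {u v : V}
    (huv : u ≠ v) (hv : ∀ e ∈ A, v ∉ e) :
    #(lifts K (insert s(u, v) A)) * Fintype.card α = #(lifts K A) := by
  classical
  rw [← card_filter_adj_mul hK (lifts K A) huv]
  · congr 2
    ext x
    simp [mem_lifts, and_comm]
  · intro x hx i
    rw [mem_lifts] at hx ⊢
    intro e he
    convert hx e he using 1
    refine Sym2.map_congr fun w hw => ?_
    have : w ≠ v := by rintro rfl; exact hv e he hw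
    simp [this]

theorem card_lifts_forest (hK : PerfectlyMatched K) {A : Finset (Sym2 V)}
    (hd : ∀ e ∈ A, ¬ e.IsDiag) (hA : #A ≤ 4) (ht : TriangleFree A) (hs : ¬ IsSquare4 A) :
    #(lifts K A) * Fintype.card α ^ #A = Fintype.card α ^ Fintype.card V := by
  induction hk : #A generalizing A with
  | zero =>
    rw [card_eq_zero] at hk
    subst hk
    simp [card_lifts_empty]
  | succ k ih =>
    obtain ⟨u, v, huv, he, hleaf⟩ := exists_leaf (card_pos.1 (by omega)) hd hA ht hs
    have hc : #(A.erase s(u, v)) = k := by rw [card_erase_of_mem he]; omega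
    have := ih (A := A.erase s(u, v)) (fun e h => hd e (mem_of_mem_erase h)) (by omega)
      (ht.mono (erase_subset _ _)) (fun h => by have := h.card_eq; omega) hc
    rw [← this, ← card_lifts_insert_mul hK huv (A := A.erase s(u, v)), insert_erase he]
    · ring
    · intro e h hve
      exact ne_of_mem_erase h (hleaf e (mem_of_mem_erase h) hve)

/-- Every edge on the three vertices already belongs to the triangle, so an additional edge has an
endpoint outside it and costs a factor m. -/
theorem card_lifts_ssuperset_triangle (hK : PerfectlyMatched K) {A B : Finset (Sym2 V)}
    (hd : ∀ e ∈ B, ¬ e.IsDiag) (hA : IsTriangle A) (hAB : A ⊂ B) :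
    #(lifts K B) * Fintype.card α ≤ #(lifts K A) := by
  obtain ⟨e, heB, heA⟩ := exists_of_ssubset hAB
  obtain ⟨a, b, c, hab, hbc, hca, rfl⟩ := hA
  have key : ∀ u v, u ≠ v → s(u, v) ∈ B → v ≠ a → v ≠ b → v ≠ c →
      #(lifts K B) * Fintype.card α ≤ #(lifts K (triangleEdges a b c)) := by
    intro u v huv he h1 h2 h3
    rw [← card_lifts_insert_mul hK huv (A := triangleEdges a b c)
      (by simp [triangleEdges, h1, h2, h3])]
    exact Nat.mul_le_mul_right _ (card_le_card (lifts_anti (insert_subset he hAB.1)))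
  induction e using Sym2.ind with
  | _ x y =>
  have hxy : x ≠ y := by simpa using hd _ heB
  by_cases hy : y ≠ a ∧ y ≠ b ∧ y ≠ c
  · exact key x y hxy heB hy.1 hy.2.1 hy.2.2
  · have hx : x ≠ a ∧ x ≠ b ∧ x ≠ c := by
      simp only [triangleEdges, mem_insert, mem_singleton, Sym2.eq_iff] at heA
      grind
    exact key y x hxy.symm (by rwa [Sym2.eq_swap]) hx.1 hx.2.1 hx.2.2

/-- Dropping one edge leaves a path of three edges, whose lifts are counted exactly. -/
theorem card_lifts_mul_le_of_square (hK : PerfectlyMatched K) {A : Finset (Sym2 V)}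
    (hd : ∀ e ∈ A, ¬ e.IsDiag) (hA : IsSquare4 A) :
    #(lifts K A) * Fintype.card α ^ 3 ≤ Fintype.card α ^ Fintype.card V := by
  obtain ⟨B, hBA, hB⟩ := exists_subset_card_eq (s := A) (n := 3) (by rw [hA.card_eq]; omega)
  rw [← card_lifts_forest hK (A := B) (fun e he => hd e (hBA he)) (by omega)
    (hA.triangleFree.mono hBA) (fun h => by have := h.card_eq; omega), hB]
  exact Nat.mul_le_mul_right _ (card_le_card (lifts_anti hBA))

/-- Three sides of the cycle form a path avoiding `v`. Together with the edge `uv` they impose four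
independent conditions, and the fourth side is ignored. -/
theorem card_lifts_mul_le_of_square_insert (hK : PerfectlyMatched K) {a b c d : V}
    (hab : a ≠ b) (hac : a ≠ c) (had : a ≠ d) (hbc : b ≠ c) (hbd : b ≠ d) (hcd : c ≠ d)
    {A : Finset (Sym2 V)} (hsub : squareEdges a b c d ⊆ A) {u v : V} (huv : u ≠ v)
    (he : s(u, v) ∈ A) (hva : v ≠ a) (hvb : v ≠ b) (hvc : v ≠ c) (hvd : v ≠ d) :
    #(lifts K A) * Fintype.card α ^ 4 ≤ Fintype.card α ^ Fintype.card V := by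
  have hS : IsSquare4 (squareEdges a b c d) := ⟨a, b, c, d, hab, hac, had, hbc, hbd, hcd, rfl⟩
  have h3 : #({s(a, b), s(b, c), s(c, d)} : Finset (Sym2 V)) = 3 := by
    rw [card_eq_three]
    refine ⟨_, _, _, ?_, ?_, ?_, rfl⟩ <;> simp <;> grind
  have hd : ∀ e ∈ ({s(a, b), s(b, c), s(c, d)} : Finset (Sym2 V)), ¬ e.IsDiag := by
    simp [hab, hbc, hcd]
  have hv : ∀ e ∈ ({s(a, b), s(b, c), s(c, d)} : Finset (Sym2 V)), v ∉ e := by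
    simp [hva, hvb, hvc, hvd]
  have hF : ({s(a, b), s(b, c), s(c, d)} : Finset (Sym2 V)) ⊆ squareEdges a b c d := by
    simp [squareEdges, insert_subset_iff]
  generalize ({s(a, b), s(b, c), s(c, d)} : Finset (Sym2 V)) = F at h3 hd hv hF
  rw [← card_lifts_forest hK (A := F) hd (by omega) (hS.triangleFree.mono hF)
    (fun h => by have := h.card_eq; omega), h3,
    ← card_lifts_insert_mul hK huv (A := F) hv, mul_assoc, ← pow_succ']
  exact Nat.mul_le_mul_right _ (card_le_card (lifts_anti (insert_subset he (hF.trans hsub))))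

theorem card_lifts_mul_le_of_triangleFree (hK : PerfectlyMatched K) {A : Finset (Sym2 V)}
    (hd : ∀ e ∈ A, ¬ e.IsDiag) (hA : 4 ≤ #A) (ht : TriangleFree A) (hs : ¬ IsSquare4 A) :
    #(lifts K A) * Fintype.card α ^ 4 ≤ Fintype.card α ^ Fintype.card V := by
  obtain ⟨B, hBA, hB⟩ := exists_subset_card_eq hA
  by_cases hsB : IsSquare4 B
  · have hne : B ⊂ A := hBA.ssubset_of_ne (by rintro rfl; exact hs hsB)
    obtain ⟨e, heA, heB⟩ := exists_of_ssubset hne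
    obtain ⟨a, b, c, d, hab, hac, had, hbc, hbd, hcd, rfl⟩ := hsB
    have h1 : s(a, b) ∈ A := hBA (by simp [squareEdges])
    have h2 : s(b, c) ∈ A := hBA (by simp [squareEdges])
    have h3 : s(c, d) ∈ A := hBA (by simp [squareEdges])
    have h4 : s(d, a) ∈ A := hBA (by simp [squareEdges])
    -- A chord of the cycle would create a triangle, so the extra edge must leave the four vertices.
    have hnac : s(c, a) ∉ A := fun h => ht _ ⟨a, b, c, hab, hbc, hac.symm, rfl⟩
      (by simp [triangleEdges, insert_subset_iff, h1, h2, h])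
    have hnbd : s(d, b) ∉ A := fun h => ht _ ⟨b, c, d, hbc, hcd, hbd.symm, rfl⟩
      (by simp [triangleEdges, insert_subset_iff, h2, h3, h])
    induction e using Sym2.ind with
    | _ x y =>
    have hxy : x ≠ y := by simpa using hd _ heA
    by_cases hy : y ≠ a ∧ y ≠ b ∧ y ≠ c ∧ y ≠ d
    · exact card_lifts_mul_le_of_square_insert hK hab hac had hbc hbd hcd hBA hxy heA
        hy.1 hy.2.1 hy.2.2.1 hy.2.2.2
    · have hx : x ≠ a ∧ x ≠ b ∧ x ≠ c ∧ x ≠ d := by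
        simp only [squareEdges, mem_insert, mem_singleton, Sym2.eq_iff] at heB
        have e1 : s(x, y) ≠ s(c, a) := fun h => hnac (h ▸ heA)
        have e2 : s(x, y) ≠ s(d, b) := fun h => hnbd (h ▸ heA)
        simp only [ne_eq, Sym2.eq_iff] at e1 e2
        grind
      exact card_lifts_mul_le_of_square_insert hK hab hac had hbc hbd hcd hBA hxy.symm
        (by rwa [Sym2.eq_swap]) hx.1 hx.2.1 hx.2.2.1 hx.2.2.2
  · rw [← card_lifts_forest hK (fun e he => hd e (hBA he)) hB.le (ht.mono hBA) hsB, hB]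
    exact Nat.mul_le_mul_right _ (card_le_card (lifts_anti hBA))

end Solutions

/-! ### Numbers of even edge sets, triangles and 4-cycles -/

section Counting

variable {V : Type*} [DecidableEq V]

theorem card_even_powerset {ι : Type*} {s : Finset ι} (hs : s.Nonempty) :
    2 * #{A ∈ s.powerset | Even #A} = 2 ^ #s ∧ 2 * #{A ∈ s.powerset | ¬ Even #A} = 2 ^ #s := by
  have h1 := card_filter_add_card_filter_not (s := s.powerset) (fun A => Even #A)
  have h2 := sum_powerset_neg_one_pow_card_of_nonempty hs
  rw [← sum_filter_add_sum_filter_not _ (fun A => Even #A),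
    sum_congr rfl (g := fun _ => (1 : ℤ)) (fun A hA => (mem_filter.1 hA).2.neg_one_pow),
    sum_congr (s₁ := filter (fun A => ¬ Even #A) _) rfl (g := fun _ => (-1 : ℤ))
      (fun A hA => (Nat.not_even_iff_odd.1 (mem_filter.1 hA).2).neg_one_pow)] at h2
  simp only [sum_const, nsmul_eq_mul, card_powerset] at h1 h2
  omega

/-- Used to absorb the deficits of the 3 C(n,4) 4-cycles, 3m^(n-4) each, into half of the error
term. From n to n + 1 the left side grows by a factor at most 5, the right side by 2^n ≥ 16. -/
theorem eighteen_mul_choose_four_le {n : ℕ} (hn : 4 ≤ n) :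
    18 * n.choose 4 ≤ 2 ^ n.choose 2 := by
  induction n, hn using Nat.le_induction with
  | base => decide
  | succ n hn ih =>
    have h1 : (n + 1).choose 4 ≤ 5 * n.choose 4 := by
      have h : n.choose 4 * 4 = n.choose 3 * (n - 3) := Nat.choose_succ_right_eq n 3
      have h2 : n.choose 3 * 1 ≤ n.choose 3 * (n - 3) := Nat.mul_le_mul_left _ (by omega)
      have h3 : (n + 1).choose 4 = n.choose 3 + n.choose 4 := Nat.choose_succ_succ' n 3
      omega
    have h2 : (n + 1).choose 2 = n + n.choose 2 := by
      rw [Nat.choose_succ_succ' n 1]; simp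
    have h3 : 2 ^ 4 ≤ 2 ^ n := Nat.pow_le_pow_right (by norm_num) hn
    rw [h2, pow_add]
    nlinarith

/-- The vertices covered by a set of edges. -/
def edgeSupport (A : Finset (Sym2 V)) : Finset V := A.biUnion Sym2.toFinset

theorem edgeSupport_triangleEdges (a b c : V) : edgeSupport (triangleEdges a b c) = {a, b, c} := by
  ext x
  simp [edgeSupport, triangleEdges]
  tauto

theorem edgeSupport_squareEdges (a b c d : V) :
    edgeSupport (squareEdges a b c d) = {a, b, c, d} := by
  ext x
  simp [edgeSupport, squareEdges]
  tauto

theorem triangleEdges_rotate (a b c : V) : triangleEdges a b c = triangleEdges b c a := by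
  ext e; simp [triangleEdges]; tauto

theorem triangleEdges_reflect (a b c : V) : triangleEdges a b c = triangleEdges a c b := by
  ext e; simp [triangleEdges, Sym2.eq_swap (a := c) (b := a), Sym2.eq_swap (a := c) (b := b),
    Sym2.eq_swap (a := b) (b := a)]; tauto

theorem squareEdges_rotate (a b c d : V) : squareEdges a b c d = squareEdges b c d a := by
  ext e; simp [squareEdges]; tauto

theorem squareEdges_reflect (a b c d : V) : squareEdges a b c d = squareEdges a d c b := by
  ext e; simp [squareEdges, Sym2.eq_swap (a := d) (b := a), Sym2.eq_swap (a := c) (b := d),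
    Sym2.eq_swap (a := c) (b := b), Sym2.eq_swap (a := b) (b := a)]; tauto

/-- After rotating the cycle to start at `a`, it is determined by the vertex opposite `a`. -/
theorem IsSquare4.eq_of_edgeSupport {A : Finset (Sym2 V)} (hA : IsSquare4 A) {a b c d : V}
    (hab : a ≠ b) (hac : a ≠ c) (had : a ≠ d) (hbc : b ≠ c) (hbd : b ≠ d) (hcd : c ≠ d)
    (h : edgeSupport A = {a, b, c, d}) :
    A = squareEdges a b c d ∨ A = squareEdges a b d c ∨ A = squareEdges a c b d := by
  have key : ∀ q r s, a ≠ q → a ≠ r → a ≠ s → q ≠ r → q ≠ s → r ≠ s → A = squareEdges a q r s →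
      A = squareEdges a b c d ∨ A = squareEdges a b d c ∨ A = squareEdges a c b d := by
    intro q r s h1 h2 h3 h4 h5 h6 hA
    rw [hA, edgeSupport_squareEdges] at h
    have e1 : b ∈ ({a, q, r, s} : Finset V) := by simp [h]
    have e2 : c ∈ ({a, q, r, s} : Finset V) := by simp [h]
    have e3 : d ∈ ({a, q, r, s} : Finset V) := by simp [h]
    simp only [mem_insert, mem_singleton, hab.symm, hac.symm, had.symm, false_or] at e1 e2 e3
    have := squareEdges_reflect a q r s
    grind
  obtain ⟨p, q, r, s, h1, h2, h3, h4, h5, h6, hAe⟩ := hA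
  have ha : a ∈ ({p, q, r, s} : Finset V) := by
    rw [← edgeSupport_squareEdges, ← hAe, h]; simp
  simp only [mem_insert, mem_singleton] at ha
  rcases ha with rfl | rfl | rfl | rfl
  · exact key q r s h1 h2 h3 h4 h5 h6 hAe
  · exact key r s p h4 h5 h1.symm h6 h2.symm h3.symm (hAe.trans (squareEdges_rotate _ _ _ _))
  · exact key s p q h6 h2.symm h4.symm h3.symm h5.symm h1
      (hAe.trans ((squareEdges_rotate _ _ _ _).trans (squareEdges_rotate _ _ _ _)))
  · exact key p q r h3.symm h5.symm h6.symm h1 h2 h4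
      (hAe.trans ((squareEdges_rotate _ _ _ _).trans
        ((squareEdges_rotate _ _ _ _).trans (squareEdges_rotate _ _ _ _))))

theorem squareEdges_diag_notMem {a b c d : V}
    (hab : a ≠ b) (hac : a ≠ c) (had : a ≠ d) (hbc : b ≠ c) (hcd : c ≠ d) :
    s(a, c) ∉ squareEdges a b c d := by
  simp [squareEdges]; grind

variable [Fintype V]

open Classical in
theorem card_triangles : #{A : Finset (Sym2 V) | IsTriangle A} = (Fintype.card V).choose 3 := by
  rw [← card_univ, ← card_powersetCard]
  refine card_bij (fun A _ => edgeSupport A) ?_ ?_ ?_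
  · intro A hA
    obtain ⟨a, b, c, hab, hbc, hca, rfl⟩ := (mem_filter.1 hA).2
    rw [mem_powersetCard, edgeSupport_triangleEdges]
    exact ⟨subset_univ _, card_eq_three.2 ⟨a, b, c, hab, hca.symm, hbc, rfl⟩⟩
  · intro A hA B hB h
    obtain ⟨a, b, c, hab, hbc, hca, rfl⟩ := (mem_filter.1 hA).2
    obtain ⟨p, q, r, hpq, hqr, hrp, rfl⟩ := (mem_filter.1 hB).2
    simp only [edgeSupport_triangleEdges] at h
    have e1 : a ∈ ({p, q, r} : Finset V) := by simp [← h]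
    have e2 : b ∈ ({p, q, r} : Finset V) := by simp [← h]
    have e3 : c ∈ ({p, q, r} : Finset V) := by simp [← h]
    simp only [mem_insert, mem_singleton] at e1 e2 e3
    have := triangleEdges_rotate p q r
    have := triangleEdges_rotate q r p
    have := triangleEdges_reflect p q r
    have := triangleEdges_reflect q r p
    have := triangleEdges_reflect r p q
    grind
  · intro S hS
    obtain ⟨a, b, c, hab, hac, hbc, rfl⟩ := card_eq_three.1 (mem_powersetCard.1 hS).2
    exact ⟨triangleEdges a b c, by simp; exact ⟨a, b, c, hab, hbc, hac.symm, rfl⟩,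
      edgeSupport_triangleEdges a b c⟩

open Classical in
theorem card_squares :
    #{A : Finset (Sym2 V) | IsSquare4 A} = 3 * (Fintype.card V).choose 4 := by
  rw [card_eq_sum_card_fiberwise (f := edgeSupport) (t := powersetCard 4 univ)]
  · rw [sum_const_nat (m := 3), card_powersetCard, card_univ, mul_comm]
    intro S hS
    obtain ⟨a, b, c, d, hab, hac, had, hbc, hbd, hcd, rfl⟩ :=
      card_eq_four.1 (mem_powersetCard.1 hS).2
    have n1 := squareEdges_diag_notMem hab hac had hbc hcd
    have n2 := squareEdges_diag_notMem hac hab had hbc.symm hbd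
    rw [card_eq_three]
    refine ⟨squareEdges a b c d, squareEdges a b d c, squareEdges a c b d, ?_, ?_, ?_, ?_⟩
    · intro h; rw [h] at n1; simp [squareEdges] at n1
    · intro h; rw [h] at n1; simp [squareEdges] at n1
    · intro h; rw [← h] at n2; simp [squareEdges] at n2
    · ext A
      simp only [mem_filter, mem_univ, true_and, mem_insert, mem_singleton]
      constructor
      · rintro ⟨hA, h⟩
        exact hA.eq_of_edgeSupport hab hac had hbc hbd hcd h
      · rintro (rfl | rfl | rfl)
        · exact ⟨⟨a, b, c, d, hab, hac, had, hbc, hbd, hcd, rfl⟩, edgeSupport_squareEdges _ _ _ _⟩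
        · refine ⟨⟨a, b, d, c, hab, had, hac, hbd, hbc, hcd.symm, rfl⟩, ?_⟩
          rw [edgeSupport_squareEdges, Finset.pair_comm d c]
        · refine ⟨⟨a, c, b, d, hac, hab, had, hbc.symm, hcd, hbd, rfl⟩, ?_⟩
          rw [edgeSupport_squareEdges, Finset.insert_comm c b]
  · intro A hA
    obtain ⟨a, b, c, d, hab, hac, had, hbc, hbd, hcd, rfl⟩ := (mem_filter.1 hA).2
    rw [mem_coe, mem_powersetCard, edgeSupport_squareEdges]
    exact ⟨subset_univ _, card_eq_four.2 ⟨a, b, c, d, hab, hac, had, hbc, hbd, hcd, rfl⟩⟩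

end Counting

/-! ### Inclusion-exclusion and the two estimates -/

section Expansion

variable {V α : Type*} [Fintype V] [DecidableEq V] [Fintype α]

/-- All edges of the complete graph on `V`. -/
def completeEdges (V : Type*) [Fintype V] [DecidableEq V] : Finset (Sym2 V) := {e | ¬ e.IsDiag}

theorem card_completeEdges : #(completeEdges V) = (Fintype.card V).choose 2 := by
  rw [← Sym2.card_subtype_not_diag, Fintype.card_subtype]
  rfl

theorem not_isDiag_of_subset {A : Finset (Sym2 V)} (h : A ⊆ completeEdges V) :
    ∀ e ∈ A, ¬ e.IsDiag := fun e he => by simpa [completeEdges] using h he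

theorem IsTriangle.subset_completeEdges {A : Finset (Sym2 V)} (h : IsTriangle A) :
    A ⊆ completeEdges V := by
  obtain ⟨a, b, c, hab, hbc, hca, rfl⟩ := h
  simp [completeEdges, triangleEdges, insert_subset_iff, hab, hbc, hca]

theorem IsSquare4.subset_completeEdges {A : Finset (Sym2 V)} (h : IsSquare4 A) :
    A ⊆ completeEdges V := by
  obtain ⟨a, b, c, d, hab, hac, had, hbc, hbd, hcd, rfl⟩ := h
  simp [completeEdges, squareEdges, insert_subset_iff, hab, hbc, hcd, had.symm]

open Classical in
/-- The labelings for which no edge of the complete graph lifts to an edge of `K`. -/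
noncomputable def independentLabelings (K : SimpleGraph (V × α)) : Finset (V → α) :=
  {x | ∀ e ∈ completeEdges V, e.map (fun v => (v, x v)) ∉ K.edgeSet}

theorem card_independentLabelings (K : SimpleGraph (V × α)) :
    (#(independentLabelings K) : ℤ) =
      ∑ A ∈ (completeEdges V).powerset, (-1) ^ #A * (#(lifts K A) : ℤ) := by
  classical
  have h := inclusion_exclusion_card_inf_compl (completeEdges V) (fun e => lifts K {e})
  have h1 : (completeEdges V).inf (fun e => (lifts K {e})ᶜ) = independentLabelings K := by
    ext x
    simp [independentLabelings, mem_inf, mem_lifts]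
  have h2 : ∀ A : Finset (Sym2 V), A.inf (fun e => lifts K {e}) = lifts K A := by
    intro A
    ext x
    simp [mem_inf, mem_lifts]
  simpa only [h1, h2] using h

open Classical in
/-- The main contribution of an edge set to the inclusion-exclusion expansion. -/
noncomputable def mainTerm (n m : ℕ) (A : Finset (Sym2 V)) : ℤ :=
  (if #A ≤ 3 then (-1) ^ #A * (m : ℤ) ^ (n - #A) else 0)
    + (if IsTriangle A then (m : ℤ) ^ (n - 3) else 0)
    + (if IsSquare4 A then (m : ℤ) ^ (n - 3) else 0)

open Classical in
theorem filter_triangle_powerset :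
    (completeEdges V).powerset.filter IsTriangle = ({A | IsTriangle A} : Finset _) := by
  ext A
  simpa using IsTriangle.subset_completeEdges

open Classical in
theorem filter_square_powerset :
    (completeEdges V).powerset.filter IsSquare4 = ({A | IsSquare4 A} : Finset _) := by
  ext A
  simpa using IsSquare4.subset_completeEdges

theorem six_le_choose_two {n : ℕ} (hn : 4 ≤ n) : 6 ≤ n.choose 2 :=
  (by decide : 6 ≤ Nat.choose 4 2).trans (Nat.choose_le_choose 2 hn)

theorem sum_mainTerm (hn : 4 ≤ Fintype.card V) (m : ℕ) :
    ∑ A ∈ (completeEdges V).powerset, mainTerm (Fintype.card V) m A =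
      DPColoring.mainPart (Fintype.card V) m := by
  classical
  set n := Fintype.card V with hn'
  simp only [mainTerm, sum_add_distrib]
  rw [sum_powerset_apply_card (fun k => if k ≤ 3 then (-1 : ℤ) ^ k * (m : ℤ) ^ (n - k) else 0),
    ← sum_filter, ← sum_filter, filter_triangle_powerset, filter_square_powerset,
    sum_const, sum_const, card_triangles, card_squares, card_completeEdges, ← hn']
  have h6 := six_le_choose_two hn
  rw [← sum_subset (s₁ := range 4) (range_subset_range.2 (by omega))]
  · simp [sum_range_succ, DPColoring.mainPart]
    ring
  · intro k _ hk
    rw [mem_range, not_lt] at hk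
    simp [show ¬ k ≤ 3 by omega]

variable {K : SimpleGraph (V × α)}

omit [DecidableEq V] in
theorem pow_card_split {k : ℕ} (hk : k ≤ Fintype.card V) :
    Fintype.card α ^ Fintype.card V = Fintype.card α ^ (Fintype.card V - k) * Fintype.card α ^ k := by
  rw [← pow_add, Nat.sub_add_cancel hk]

theorem card_lifts_eq_pow (hK : PerfectlyMatched K) (hn : 4 ≤ Fintype.card V)
    (hm : 0 < Fintype.card α) {A : Finset (Sym2 V)} (hd : A ⊆ completeEdges V) (hA : #A ≤ 3)
    (ht : TriangleFree A) : #(lifts K A) = Fintype.card α ^ (Fintype.card V - #A) := by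
  have h := card_lifts_forest hK (not_isDiag_of_subset hd) (by omega) ht
    (fun h => by have := h.card_eq; omega)
  rw [pow_card_split (k := #A) (by omega)] at h
  exact Nat.eq_of_mul_eq_mul_right (by positivity) h

theorem card_lifts_le_pow (hK : PerfectlyMatched K) (hn : 4 ≤ Fintype.card V)
    (hm : 0 < Fintype.card α) {A : Finset (Sym2 V)} (hd : A ⊆ completeEdges V) (hA : 4 ≤ #A)
    (ht : TriangleFree A) (hs : ¬ IsSquare4 A) :
    #(lifts K A) ≤ Fintype.card α ^ (Fintype.card V - 4) := by
  have h := card_lifts_mul_le_of_triangleFree hK (not_isDiag_of_subset hd) hA ht hs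
  rw [pow_card_split hn] at h
  exact Nat.le_of_mul_le_mul_right h (by positivity)

theorem card_lifts_square_le_pow (hK : PerfectlyMatched K) (hn : 4 ≤ Fintype.card V)
    (hm : 0 < Fintype.card α) {A : Finset (Sym2 V)} (hA : IsSquare4 A) :
    #(lifts K A) ≤ Fintype.card α ^ (Fintype.card V - 3) := by
  have h := card_lifts_mul_le_of_square hK (not_isDiag_of_subset hA.subset_completeEdges) hA
  rw [pow_card_split (k := 3) (by omega)] at h
  exact Nat.le_of_mul_le_mul_right h (by positivity)

-- The triangle correction cancels the generic value (-1)^3 m^(n-3), so that actual triangle lifts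
-- can be accounted for separately.
omit [Fintype V] in
theorem mainTerm_of_triangle {n m : ℕ} {A : Finset (Sym2 V)} (hA : IsTriangle A) :
    mainTerm n m A = 0 := by
  have h3 := hA.card_eq
  have hs : ¬ IsSquare4 A := fun h => by have := h.card_eq; omega
  simp only [mainTerm, h3, hA, hs, le_refl, if_true, if_false]
  ring

omit [Fintype V] in
theorem mainTerm_of_large {n m : ℕ} {A : Finset (Sym2 V)} (h4 : 4 ≤ #A) (hs : ¬ IsSquare4 A) :
    mainTerm n m A = 0 := by
  have h3 : ¬ #A ≤ 3 := by omega
  have ht : ¬ IsTriangle A := fun h => by have := h.card_eq; omega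
  simp [mainTerm, h3, hs, ht]

omit [Fintype V] in
theorem mainTerm_of_square {n m : ℕ} {A : Finset (Sym2 V)} (hs : IsSquare4 A) :
    mainTerm n m A = (m : ℤ) ^ (n - 3) := by
  have h4 := hs.card_eq
  have ht : ¬ IsTriangle A := fun h => by have := h.card_eq; omega
  simp [mainTerm, h4, hs, ht]

omit [Fintype V] in
theorem mainTerm_of_small {n m : ℕ} {A : Finset (Sym2 V)} (h3 : #A ≤ 3) (ht : ¬ IsTriangle A) :
    mainTerm n m A = (-1) ^ #A * (m : ℤ) ^ (n - #A) := by
  have hs : ¬ IsSquare4 A := fun h => by have := h.card_eq; omega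
  simp [mainTerm, h3, hs, ht]

omit [Fintype V] in
theorem TriangleFree.not_isTriangle {A : Finset (Sym2 V)} (h : TriangleFree A) : ¬ IsTriangle A :=
  fun hA => h A hA subset_rfl

omit [Fintype V] in
theorem exists_triangle_of_not_triangleFree {A : Finset (Sym2 V)} (h : ¬ TriangleFree A) :
    ∃ B, IsTriangle B ∧ B ⊆ A := by
  simpa [TriangleFree] using h

open Classical in
/-- The number of pairs of a triangle of the complete graph and a lift of it. -/
noncomputable def triangleLifts (K : SimpleGraph (V × α)) : ℕ :=
  ∑ B : Finset (Sym2 V) with IsTriangle B, #(lifts K B)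

-- Multiplying by m avoids dividing the triangle lifts by m. Odd sets other than small forests and
-- triangles can only lower the sum, so the error is charged to even sets alone. 4-cycles cause no
-- error since `mainTerm` already gives them their maximum. If A properly contains a triangle, m
-- times its lifts is bounded crudely by the total `triangleLifts K`.
open Classical in
theorem term_le (hK : PerfectlyMatched K) (hn : 4 ≤ Fintype.card V) (hm : 0 < Fintype.card α)
    {A : Finset (Sym2 V)} (hd : A ⊆ completeEdges V) :
    (Fintype.card α : ℤ) * ((-1) ^ #A * (#(lifts K A) : ℤ)) ≤
      Fintype.card α * mainTerm (Fintype.card V) (Fintype.card α) A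
        + (if Even #A then (Fintype.card α : ℤ) * (Fintype.card α : ℤ) ^ (Fintype.card V - 4)
          + triangleLifts K else 0)
        - (if IsTriangle A then (Fintype.card α : ℤ) * #(lifts K A) else 0) := by
  have hE : (0 : ℤ) ≤ if Even #A then (Fintype.card α : ℤ) *
      (Fintype.card α : ℤ) ^ (Fintype.card V - 4) + triangleLifts K else 0 := by
    split_ifs <;> positivity
  by_cases ht : TriangleFree A
  · rw [if_neg ht.not_isTriangle]
    by_cases h3 : #A ≤ 3
    · rw [mainTerm_of_small h3 ht.not_isTriangle, card_lifts_eq_pow hK hn hm hd h3 ht]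
      push_cast
      linarith
    by_cases hs : IsSquare4 A
    · have h := card_lifts_square_le_pow hK hn hm hs
      rw [mainTerm_of_square hs]
      have h' : ((-1) ^ #A * (#(lifts K A) : ℤ)) ≤
          (Fintype.card α : ℤ) ^ (Fintype.card V - 3) := by
        rw [hs.card_eq]
        norm_num
        exact_mod_cast h
      have := mul_le_mul_of_nonneg_left h' (Nat.cast_nonneg (α := ℤ) (Fintype.card α))
      linarith
    · rw [mainTerm_of_large (by omega) hs]
      have h := card_lifts_le_pow hK hn hm hd (by omega) ht hs
      by_cases he : Even #A
      · rw [he.neg_one_pow, if_pos he]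
        have h' : (#(lifts K A) : ℤ) ≤ (Fintype.card α : ℤ) ^ (Fintype.card V - 4) := by
          exact_mod_cast h
        have := mul_le_mul_of_nonneg_left h' (Nat.cast_nonneg (α := ℤ) (Fintype.card α))
        have : (0 : ℤ) ≤ triangleLifts K := by positivity
        linarith
      · rw [(Nat.not_even_iff_odd.1 he).neg_one_pow]
        have : (0 : ℤ) ≤ Fintype.card α * #(lifts K A) := by positivity
        linarith
  · obtain ⟨B, hB, hBA⟩ := exists_triangle_of_not_triangleFree ht
    by_cases hA : IsTriangle A
    · rw [mainTerm_of_triangle hA, if_pos hA, hA.card_eq]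
      have : ¬ Even 3 := by decide
      rw [if_neg this]
      linarith
    · have hs : ¬ IsSquare4 A := fun h => ht h.triangleFree
      have hBA' : B ⊂ A := hBA.ssubset_of_ne (by rintro rfl; exact hA hB)
      have h4 : 4 ≤ #A := by
        have := card_lt_card hBA'
        rw [hB.card_eq] at this
        exact this
      rw [mainTerm_of_large h4 hs, if_neg hA]
      by_cases he : Even #A
      · rw [he.neg_one_pow, if_pos he]
        have h1 := card_lifts_ssuperset_triangle hK (not_isDiag_of_subset hd) hB hBA'
        have h2 : #(lifts K B) ≤ triangleLifts K :=
          single_le_sum (f := fun B => #(lifts K B)) (fun _ _ => Nat.zero_le _) (by simp [hB])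
        have h3 : (#(lifts K A) : ℤ) * Fintype.card α ≤ triangleLifts K := by
          exact_mod_cast h1.trans h2
        have : (0 : ℤ) ≤ (Fintype.card α : ℤ) * (Fintype.card α : ℤ) ^ (Fintype.card V - 4) := by
          positivity
        linarith
      · rw [(Nat.not_even_iff_odd.1 he).neg_one_pow]
        have : (0 : ℤ) ≤ Fintype.card α * #(lifts K A) := by positivity
        linarith

theorem completeEdges_nonempty (hn : 4 ≤ Fintype.card V) : (completeEdges V).Nonempty := by
  have := six_le_choose_two hn
  rw [← card_pos, card_completeEdges]
  omega

theorem two_mul_card_independentLabelings_le (hK : PerfectlyMatched K) (hn : 4 ≤ Fintype.card V)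
    (hm : 0 < Fintype.card α) :
    2 * Fintype.card α * (#(independentLabelings K) : ℤ) ≤
      2 * Fintype.card α * DPColoring.mainPart (Fintype.card V) (Fintype.card α)
        + 2 ^ (Fintype.card V).choose 2 *
          (Fintype.card α * (Fintype.card α : ℤ) ^ (Fintype.card V - 4) + triangleLifts K)
        - 2 * Fintype.card α * triangleLifts K := by
  classical
  have h := sum_le_sum (fun A hA => term_le hK hn hm (mem_powerset.1 hA))
  rw [← mul_sum, ← card_independentLabelings, sum_sub_distrib, sum_add_distrib, ← mul_sum,
    sum_mainTerm hn, ← sum_filter, ← sum_filter, filter_triangle_powerset, sum_const, ← mul_sum,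
    nsmul_eq_mul] at h
  have hT : ∑ B : Finset (Sym2 V) with IsTriangle B, (#(lifts K B) : ℤ) = triangleLifts K := by
    simp [triangleLifts]
  have hU : (2 : ℤ) * #{A ∈ (completeEdges V).powerset | Even #A} =
      2 ^ (Fintype.card V).choose 2 := by
    rw [← card_completeEdges]
    exact_mod_cast (card_even_powerset (completeEdges_nonempty hn)).1
  rw [hT] at h
  rw [← hU]
  linarith

theorem card_independentLabelings_le (hK : PerfectlyMatched K) (hn : 4 ≤ Fintype.card V)
    (hm : 2 ^ (Fintype.card V).choose 2 ≤ Fintype.card α) :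
    (#(independentLabelings K) : ℤ) ≤
      DPColoring.mainPart (Fintype.card V) (Fintype.card α)
        + 2 ^ (Fintype.card V).choose 2 * (Fintype.card α : ℤ) ^ (Fintype.card V - 4) := by
  have hm0 : 0 < Fintype.card α := lt_of_lt_of_le (by positivity) hm
  have h := two_mul_card_independentLabelings_le hK hn hm0
  have hm' : (2 : ℤ) ^ (Fintype.card V).choose 2 ≤ Fintype.card α := by exact_mod_cast hm
  have h1 := mul_le_mul_of_nonneg_right hm' (Nat.cast_nonneg (α := ℤ) (triangleLifts K))
  have h2 : (0 : ℤ) ≤ Fintype.card α * triangleLifts K := by positivity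
  have h3 : (0 : ℤ) ≤ 2 ^ (Fintype.card V).choose 2 *
      (Fintype.card α * (Fintype.card α : ℤ) ^ (Fintype.card V - 4)) := by positivity
  have hm0' : (0 : ℤ) < 2 * Fintype.card α := by exact_mod_cast (by omega)
  refine le_of_mul_le_mul_left ?_ hm0'
  linarith

/-- A graph with a triangle across the parts has few independent labelings. -/
theorem card_independentLabelings_lt (hK : PerfectlyMatched K) (hn : 4 ≤ Fintype.card V)
    (hm : 2 ^ ((Fintype.card V).choose 2 + 1) < Fintype.card α)
    (hT : Fintype.card α ^ (Fintype.card V - 3) ≤ triangleLifts K) :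
    (#(independentLabelings K) : ℤ) <
      DPColoring.mainPart (Fintype.card V) (Fintype.card α)
        - 2 ^ (Fintype.card V).choose 2 * (Fintype.card α : ℤ) ^ (Fintype.card V - 4) := by
  have hm0 : 0 < Fintype.card α := lt_of_le_of_lt (by positivity) hm
  have h := two_mul_card_independentLabelings_le hK hn hm0
  have hm' : (2 : ℤ) * 2 ^ (Fintype.card V).choose 2 < Fintype.card α := by
    rw [pow_succ'] at hm
    exact_mod_cast hm
  have hT' : (Fintype.card α : ℤ) * (Fintype.card α : ℤ) ^ (Fintype.card V - 4) ≤
      triangleLifts K := by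
    rw [← pow_succ', show Fintype.card V - 4 + 1 = Fintype.card V - 3 by omega]
    exact_mod_cast hT
  have hm0' : (0 : ℤ) < Fintype.card α := by exact_mod_cast hm0
  have ha : (0 : ℤ) < (Fintype.card α : ℤ) ^ (Fintype.card V - 4) := by positivity
  have hq : (0 : ℤ) < 2 ^ (Fintype.card V).choose 2 := by positivity
  refine lt_of_mul_lt_mul_left ?_ (by positivity : (0 : ℤ) ≤ 2 * Fintype.card α)
  generalize (Fintype.card α : ℤ) ^ (Fintype.card V - 4) = a at *
  generalize (2 : ℤ) ^ (Fintype.card V).choose 2 = q at *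
  generalize (Fintype.card α : ℤ) = m at *
  -- With q = 2^t and a = m^(n-4), replacing T by its lower bound ma leaves an excess of 2ma(q - m)
  -- over 2m f(m), which is less than -2maq exactly when m > 2q.
  have h1 := mul_le_mul_of_nonneg_left hT' (by linarith : (0 : ℤ) ≤ 2 * m - q)
  have h2 : 0 < m * a * (m - 2 * q) := mul_pos (mul_pos hm0' ha) (by linarith)
  nlinarith

-- Without triangle lifts, every set containing a triangle contributes 0. What can fall short of
-- `mainTerm` is then an odd set, by at most m^(n-4), or a 4-cycle, by the deficit allowed in `h4`.
open Classical in
theorem le_term (hK : PerfectlyMatched K) (hn : 4 ≤ Fintype.card V) (hm : 0 < Fintype.card α)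
    (h3 : ∀ A : Finset (Sym2 V), IsTriangle A → lifts K A = ∅)
    (h4 : ∀ A : Finset (Sym2 V), IsSquare4 A → Fintype.card α ^ (Fintype.card V - 3) ≤
      #(lifts K A) + 3 * Fintype.card α ^ (Fintype.card V - 4))
    {A : Finset (Sym2 V)} (hd : A ⊆ completeEdges V) :
    mainTerm (Fintype.card V) (Fintype.card α) A
        - (if ¬ Even #A then (Fintype.card α : ℤ) ^ (Fintype.card V - 4) else 0)
        - (if IsSquare4 A then 3 * (Fintype.card α : ℤ) ^ (Fintype.card V - 4) else 0) ≤
      (-1) ^ #A * (#(lifts K A) : ℤ) := by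
  have hE : (0 : ℤ) ≤ if ¬ Even #A then (Fintype.card α : ℤ) ^ (Fintype.card V - 4) else 0 := by
    split_ifs <;> positivity
  by_cases ht : TriangleFree A
  · by_cases hA : #A ≤ 3
    · rw [mainTerm_of_small hA ht.not_isTriangle, card_lifts_eq_pow hK hn hm hd hA ht,
        if_neg (c := IsSquare4 A) (fun h => by have := h.card_eq; omega)]
      push_cast
      linarith
    by_cases hs : IsSquare4 A
    · have h := h4 A hs
      have h' : (Fintype.card α : ℤ) ^ (Fintype.card V - 3) ≤
        #(lifts K A) + 3 * (Fintype.card α : ℤ) ^ (Fintype.card V - 4) := by exact_mod_cast h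
      rw [mainTerm_of_square hs, if_pos hs, hs.card_eq]
      rw [hs.card_eq] at hE
      linarith
    · rw [mainTerm_of_large (by omega) hs, if_neg hs]
      by_cases he : Even #A
      · rw [he.neg_one_pow]
        have : (0 : ℤ) ≤ #(lifts K A) := by positivity
        linarith
      · rw [(Nat.not_even_iff_odd.1 he).neg_one_pow, if_pos he]
        have h' : (#(lifts K A) : ℤ) ≤ (Fintype.card α : ℤ) ^ (Fintype.card V - 4) := by
          exact_mod_cast card_lifts_le_pow hK hn hm hd (by omega) ht hs
        linarith
  · obtain ⟨B, hB, hBA⟩ := exists_triangle_of_not_triangleFree ht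
    have h0 : lifts K A = ∅ := subset_empty.1 (h3 B hB ▸ lifts_anti hBA)
    have hs : ¬ IsSquare4 A := fun h => ht h.triangleFree
    have hmain : mainTerm (Fintype.card V) (Fintype.card α) A = 0 := by
      by_cases hA : IsTriangle A
      · exact mainTerm_of_triangle hA
      · refine mainTerm_of_large ?_ hs
        have := card_lt_card (hBA.ssubset_of_ne (by rintro rfl; exact hA hB))
        rw [hB.card_eq] at this
        exact this
    rw [hmain, if_neg hs, h0]
    simp only [card_empty, Nat.cast_zero, mul_zero]
    linarith

theorem le_card_independentLabelings (hK : PerfectlyMatched K) (hn : 4 ≤ Fintype.card V)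
    (hm : 0 < Fintype.card α) (h3 : ∀ A : Finset (Sym2 V), IsTriangle A → lifts K A = ∅)
    (h4 : ∀ A : Finset (Sym2 V), IsSquare4 A → Fintype.card α ^ (Fintype.card V - 3) ≤
      #(lifts K A) + 3 * Fintype.card α ^ (Fintype.card V - 4)) :
    DPColoring.mainPart (Fintype.card V) (Fintype.card α)
        - 2 ^ (Fintype.card V).choose 2 * (Fintype.card α : ℤ) ^ (Fintype.card V - 4) ≤
      (#(independentLabelings K) : ℤ) := by
  classical
  have h := sum_le_sum (fun A hA => le_term hK hn hm h3 h4 (mem_powerset.1 hA))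
  rw [← card_independentLabelings, sum_sub_distrib, sum_sub_distrib,
    sum_mainTerm hn, ← sum_filter, ← sum_filter, filter_square_powerset, sum_const, sum_const,
    card_squares, nsmul_eq_mul, nsmul_eq_mul] at h
  have hU : (2 : ℤ) * #{A ∈ (completeEdges V).powerset | ¬ Even #A} =
      2 ^ (Fintype.card V).choose 2 := by
    rw [← card_completeEdges]
    exact_mod_cast (card_even_powerset (completeEdges_nonempty hn)).2
  have hC : (18 : ℤ) * (Fintype.card V).choose 4 ≤ 2 ^ (Fintype.card V).choose 2 := by
    exact_mod_cast eighteen_mul_choose_four_le hn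
  have ha : (0 : ℤ) ≤ (Fintype.card α : ℤ) ^ (Fintype.card V - 4) := by positivity
  have := mul_le_mul_of_nonneg_right hC ha
  rw [← hU] at this ⊢
  push_cast at h
  linarith

end Expansion

/-! ### A cover with no triangles and almost all 4-cycles -/

section TwistedGraph

variable {V α : Type*} [Fintype V] [DecidableEq V] [Fintype α]

theorem mem_independentLabelings {K : SimpleGraph (V × α)} {x : V → α} :
    x ∈ independentLabelings K ↔ ∀ u v, u ≠ v → ¬ K.Adj (u, x u) (v, x v) := by
  simp only [independentLabelings, mem_filter_univ]
  simp [completeEdges, Sym2.forall]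

open Classical in
theorem card_filter_agree (S : Finset V) (y : V → α) :
    #{x : V → α | ∀ v ∈ S, x v = y v} = Fintype.card α ^ (Fintype.card V - #S) := by
  have h : ({x : V → α | ∀ v ∈ S, x v = y v} : Finset _) =
      Fintype.piFinset (fun v => if v ∈ S then {y v} else univ) := by
    ext x
    simp only [mem_filter, mem_univ, true_and, Fintype.mem_piFinset]
    refine forall_congr' fun v => ?_
    by_cases hv : v ∈ S <;> simp [hv]
  have h2 : ∀ v, #(if v ∈ S then ({y v} : Finset α) else univ) =
      if v ∈ S then 1 else Fintype.card α := by
    intro v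
    split_ifs <;> simp
  rw [h, Fintype.card_piFinset, prod_congr rfl (fun v _ => h2 v), prod_ite]
  simp only [prod_const, one_pow, one_mul]
  congr 1
  rw [← card_compl]
  congr 1
  ext v
  simp

/-- One triangle of `K` fixes three labels and leaves the other n - 3 free. -/
theorem pow_le_triangleLifts {K : SimpleGraph (V × α)} {u v w : V} (huv : u ≠ v) (hvw : v ≠ w)
    (hwu : w ≠ u) {i j k : α} (h1 : K.Adj (u, i) (v, j)) (h2 : K.Adj (v, j) (w, k))
    (h3 : K.Adj (w, k) (u, i)) :
    Fintype.card α ^ (Fintype.card V - 3) ≤ triangleLifts K := by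
  classical
  have hT : IsTriangle (triangleEdges u v w) := ⟨u, v, w, huv, hvw, hwu, rfl⟩
  have hle : #(lifts K (triangleEdges u v w)) ≤ triangleLifts K :=
    single_le_sum (f := fun B => #(lifts K B)) (fun _ _ => Nat.zero_le _) (by simp [hT])
  refine le_trans ?_ hle
  have hS : #({u, v, w} : Finset V) = 3 := card_eq_three.2 ⟨u, v, w, huv, hwu.symm, hvw, rfl⟩
  rw [← hS, ← card_filter_agree {u, v, w} (fun z => if z = u then i else if z = v then j else k)]
  refine card_le_card fun x hx => ?_
  simp only [mem_filter, mem_univ, true_and, mem_insert, mem_singleton, forall_eq_or_imp,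
    forall_eq, if_true, huv.symm, hwu, hvw.symm, if_false] at hx
  simp [mem_lifts, triangleEdges, hx.1, hx.2.1, hx.2.2, h1, h2, h3]

variable [LinearOrder V]

/-- The graph on `V × α` in which any two parts are matched along the permutation `σ`. -/
def twistedGraph (V : Type*) [LinearOrder V] {α : Type*} (σ : Equiv.Perm α) :
    SimpleGraph (V × α) where
  Adj p q := (p.1 < q.1 ∧ q.2 = σ p.2) ∨ (q.1 < p.1 ∧ p.2 = σ q.2)
  symm := ⟨fun _ _ h => h.symm⟩
  loopless := ⟨fun _ h => by simp at h⟩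

omit [Fintype V] [DecidableEq V] [Fintype α] in
theorem twistedGraph_adj {σ : Equiv.Perm α} {u v : V} {i j : α} :
    (twistedGraph V σ).Adj (u, i) (v, j) ↔ (u < v ∧ j = σ i) ∨ (v < u ∧ i = σ j) := Iff.rfl

omit [Fintype V] [DecidableEq V] [Fintype α] in
theorem twistedGraph_perfectlyMatched (σ : Equiv.Perm α) :
    PerfectlyMatched (twistedGraph V σ) := by
  intro u v huv i
  simp only [twistedGraph_adj]
  rcases lt_or_gt_of_ne huv with h | h
  · exact ⟨σ i, by simp [h], fun j hj => by simpa [h, h.not_gt] using hj⟩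
  · exact ⟨σ.symm i, by simp [h], fun j hj => by
      have : i = σ j := by simpa [h, h.not_gt] using hj
      simp [this]⟩

/-- Over u < v < w, the label at w is σ applied to the label at u and also σ applied to the label at
v. By injectivity these two labels agree, and v's label is σ of u's, so σ would have a fixed point.
-/
theorem lifts_twistedGraph_triangle {σ : Equiv.Perm α} (hσ : ∀ i, σ i ≠ i) {A : Finset (Sym2 V)}
    (hA : IsTriangle A) : lifts (twistedGraph V σ) A = ∅ := by
  obtain ⟨a, b, c, hab, hbc, hca, rfl⟩ := hA
  rw [eq_empty_iff_forall_notMem]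
  intro x hx
  simp only [mem_lifts, triangleEdges, mem_insert, mem_singleton, forall_eq_or_imp, forall_eq,
    Sym2.map_mk, SimpleGraph.mem_edgeSet, twistedGraph_adj] at hx
  obtain ⟨h1, h2, h3⟩ := hx
  have hinj := σ.injective
  rcases h1 with ⟨l1, e1⟩ | ⟨l1, e1⟩ <;> rcases h2 with ⟨l2, e2⟩ | ⟨l2, e2⟩ <;>
    rcases h3 with ⟨l3, e3⟩ | ⟨l3, e3⟩ <;> grind

-- If σ² fixes the label at `a`, labels along a lifted path `a b c d` alternate between i and σ i,
-- and the closing edge lifts whichever way the vertices are ordered. Hence only path lifts with a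
-- bad label at `a` can be lost.
open Classical in
theorem pow_le_card_lifts_twistedGraph_square {σ : Equiv.Perm α} (hn : 4 ≤ Fintype.card V)
    (hm : 0 < Fintype.card α) (hσ : #{i | σ (σ i) ≠ i} ≤ 3) {A : Finset (Sym2 V)}
    (hA : IsSquare4 A) :
    Fintype.card α ^ (Fintype.card V - 3) ≤
      #(lifts (twistedGraph V σ) A) + 3 * Fintype.card α ^ (Fintype.card V - 4) := by
  have hK := twistedGraph_perfectlyMatched (V := V) σ
  obtain ⟨a, b, c, d, hab, hac, had, hbc, hbd, hcd, hAe⟩ := id hA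
  set K := twistedGraph V σ with hKdef
  have hsub : ({s(a, b), s(b, c), s(c, d)} : Finset (Sym2 V)) ⊆ A := by
    rw [hAe]
    simp [squareEdges, insert_subset_iff]
  have h3 : #({s(a, b), s(b, c), s(c, d)} : Finset (Sym2 V)) = 3 := by
    rw [card_eq_three]
    refine ⟨_, _, _, ?_, ?_, ?_, rfl⟩ <;> simp <;> grind
  have hF := card_lifts_eq_pow hK hn hm (hsub.trans hA.subset_completeEdges) h3.le
    (hA.triangleFree.mono hsub)
  rw [h3] at hF
  set X : Finset (V → α) := {x | σ (σ (x a)) ≠ x a} with hX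
  -- `Y` consists of the path lifts that start at one of the at most three bad labels. The three
  -- path edges cut the at most 3m^(n-1) labelings in `X` by m³.
  set Y : Finset (V → α) := {x ∈ {x ∈ {x ∈ X | K.Adj (a, x a) (b, x b)} |
    K.Adj (b, x b) (c, x c)} | K.Adj (c, x c) (d, x d)} with hY
  have hYX : #Y * Fintype.card α ^ 3 = #X := by
    rw [← card_filter_adj_mul hK X hab, ← card_filter_adj_mul hK (filter _ X) hbc,
      ← card_filter_adj_mul hK (filter _ (filter _ X)) hcd]
    · ring
    · intro x hx i
      simpa [hX, hab, hac, had, hbc, hbd, hcd] using hx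
    · intro x hx i
      simpa [hX, hab, hac, had, hbc, hbd, hcd] using hx
    · intro x hx i
      simpa [hX, hab, hac, had, hbc, hbd, hcd] using hx
  have hXle : #X ≤ 3 * Fintype.card α ^ (Fintype.card V - 1) := by
    have hsubX : X ⊆ ({i | σ (σ i) ≠ i} : Finset α).biUnion
        (fun i => {x : V → α | ∀ v ∈ ({a} : Finset V), x v = i}) := by
      intro x hx
      simpa [hX] using hx
    refine (card_le_card hsubX).trans ((card_biUnion_le_card_mul _ _ _ fun i _ => ?_).trans
      (Nat.mul_le_mul_right _ hσ))
    rw [card_filter_agree {a} (fun _ => i), card_singleton]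
  have hYle : #Y ≤ 3 * Fintype.card α ^ (Fintype.card V - 4) := by
    refine Nat.le_of_mul_le_mul_right (c := Fintype.card α ^ 3) ?_ (by positivity)
    rw [hYX, mul_assoc, ← pow_add, show Fintype.card V - 4 + 3 = Fintype.card V - 1 by omega]
    exact hXle
  rw [← hF]
  refine le_trans (le_trans (card_le_card ?_) (card_union_le (lifts K A) Y))
    (Nat.add_le_add_left hYle _)
  intro x hx
  simp only [mem_lifts, mem_insert, mem_singleton, forall_eq_or_imp, forall_eq,
    Sym2.map_mk, SimpleGraph.mem_edgeSet] at hx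
  obtain ⟨h1, h2, h3⟩ := hx
  rw [mem_union]
  by_cases hxa : σ (σ (x a)) = x a
  · left
    simp only [hAe, squareEdges, mem_lifts, mem_insert, mem_singleton, forall_eq_or_imp, forall_eq,
      Sym2.map_mk, SimpleGraph.mem_edgeSet]
    refine ⟨h1, h2, h3, ?_⟩
    have step : ∀ {u v i j}, K.Adj (u, i) (v, j) → σ (σ i) = i → j = σ i ∧ σ (σ j) = j := by
      intro u v i j h hi
      rcases h with ⟨-, e⟩ | ⟨-, e⟩
      · have e : j = σ i := e
        exact ⟨e, by rw [e, hi]⟩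
      · have e : i = σ j := e
        have : σ i = j := σ.injective (by rw [hi, e])
        exact ⟨this.symm, by rw [← e, this]⟩
    obtain ⟨e1, f1⟩ := step h1 hxa
    obtain ⟨e2, f2⟩ := step h2 f1
    obtain ⟨e3, f3⟩ := step h3 f2
    have e4 : x c = x a := by rw [e2, e1, hxa]
    rw [hKdef, twistedGraph_adj]
    rcases lt_or_gt_of_ne had with h | h
    · right; exact ⟨h, by rw [e3, e4]⟩
    · left; exact ⟨h, by rw [e3, e4, hxa]⟩
  · right
    simp [hY, hX, hxa, h1, h2, h3]

/-- Labels are swapped in pairs. For odd m, three labels are set aside and permuted by a 3-cycle,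
which has no fixed points. -/
theorem exists_perm_almost_involution {m : ℕ} (hm : 3 ≤ m) :
    ∃ σ : Equiv.Perm (Fin m), (∀ i, σ i ≠ i) ∧ #{i | σ (σ i) ≠ i} ≤ 3 := by
  have key : ∀ (k r : ℕ) (τ : Equiv.Perm (Fin r)), (∀ i, τ i ≠ i) → r ≤ 3 → k * 2 + r = m →
      ∃ σ : Equiv.Perm (Fin m), (∀ i, σ i ≠ i) ∧ #{i | σ (σ i) ≠ i} ≤ 3 := by
    intro k r τ hτ hr hm
    have e : (Fin k × Bool) ⊕ Fin r ≃ Fin m := Fintype.equivFinOfCardEq (by simp [hm])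
    refine ⟨e.permCongr (Equiv.sumCongr (Equiv.prodCongr (Equiv.refl _) Equiv.boolNot) τ), ?_, ?_⟩
    · intro i
      obtain ⟨y, rfl⟩ := e.surjective i
      rcases y with ⟨a, b⟩ | c
      · simp [Equiv.permCongr_apply]
      · simp [Equiv.permCongr_apply, hτ]
    · refine (card_le_card (t := univ.image fun c => e (Sum.inr c)) ?_).trans
        (card_image_le.trans (by simpa using hr))
      intro i hi
      obtain ⟨y, rfl⟩ := e.surjective i
      rcases y with ⟨a, b⟩ | c
      · simp [Equiv.permCongr_apply] at hi
      · simp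
  obtain ⟨k, rfl | rfl⟩ := Nat.even_or_odd' m
  · exact key k 0 (Equiv.refl _) (fun i => i.elim0) (by norm_num) (by ring)
  · exact key (k - 1) 3 (finRotate 3) (by decide) le_rfl (by omega)

end TwistedGraph

/-! ### Translation between covers and perfectly matched graphs -/

section Covers

namespace DPColoring.DPCover

variable {V W α : Type*}

theorem part_unique {G : SimpleGraph V} (C : DPCover G W) {u v : V} {x : W} (hu : x ∈ C.L u)
    (hv : x ∈ C.L v) : u = v := by
  by_contra h
  exact Set.disjoint_left.1 (C.disjoint_parts u v h) hu hv

/-- The cover graph transported to `V × α` along labelings of the parts. -/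
def labeledGraph {G : SimpleGraph V} (C : DPCover G W) (e : ∀ v, α ≃ C.L v) :
    SimpleGraph (V × α) := C.H.comap fun p => (e p.1 p.2 : W)

/-- In a matching, an edge is determined by its end in `C.L u`. The m edges therefore have m
distinct ends there, which exhaust the part. -/
theorem exists_adj_of_isFullFold [Finite W] {G : SimpleGraph V} (C : DPCover G W) {m : ℕ}
    (hC : C.IsFullFold m) {u v : V} (huv : G.Adj u v) {x : W} (hx : x ∈ C.L u) :
    ∃ y ∈ C.L v, C.H.Adj x y := by
  classical
  set S : Set W := {x | x ∈ C.L u ∧ ∃ y ∈ C.L v, C.H.Adj x y} with hS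
  have hSL : S ⊆ C.L u := fun x hx => hx.1
  have hex : ∀ x, ∃ y, x ∈ S → y ∈ C.L v ∧ C.H.Adj x y := by
    intro x
    by_cases h : x ∈ S
    · obtain ⟨y, hy⟩ := h.2
      exact ⟨y, fun _ => hy⟩
    -- Outside `S` the value of the partner function is irrelevant.
    · exact ⟨x, fun h' => (h h').elim⟩
  choose f hf using hex
  have hsub : edgesBetween C.H (C.L u) (C.L v) ⊆ (fun x => s(x, f x)) '' S := by
    rintro e ⟨he, x, hx, y, hy, rfl⟩
    have hxS : x ∈ S := ⟨hx, y, hy, he⟩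
    have hfx := hf x hxS
    exact ⟨x, hxS, C.matching u v huv _ ⟨hfx.2, x, hx, f x, hfx.1, rfl⟩ _
      ⟨he, x, hx, y, hy, rfl⟩ x (by simp) (by simp)⟩
  have hcard : (C.L u).ncard ≤ S.ncard := by
    rw [hC.1 u, ← hC.2 u v huv]
    exact (Set.ncard_le_ncard hsub (Set.toFinite _)).trans (Set.ncard_image_le (Set.toFinite _))
  have := Set.eq_of_subset_of_ncard_le hSL hcard (Set.toFinite _)
  exact (this ▸ hx : x ∈ S).2

theorem labeledGraph_perfectlyMatched [Finite W] (C : DPCover (SimpleGraph.completeGraph V) W)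
    {m : ℕ} (hC : C.IsFullFold m) (e : ∀ v, α ≃ C.L v) : PerfectlyMatched (C.labeledGraph e) := by
  intro u v huv i
  obtain ⟨y, hy, hadj⟩ := C.exists_adj_of_isFullFold hC (u := u) (v := v) huv (e u i).2
  refine ⟨(e v).symm ⟨y, hy⟩, by simpa [labeledGraph] using hadj, fun j hj => ?_⟩
  have hj' : C.H.Adj (e u i) (e v j) := hj
  have h := C.matching u v huv _ ⟨hadj, _, (e u i).2, y, hy, rfl⟩ _
    ⟨hj', _, (e u i).2, _, (e v j).2, rfl⟩ (e u i) (by simp) (by simp)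
  have h' : y = e v j := Sym2.congr_right.1 h
  rw [Equiv.eq_symm_apply]
  exact Subtype.ext h'.symm

theorem parts_ne_of_adj (C : DPCover (SimpleGraph.completeGraph V) W) {x y : W}
    (h : C.H.Adj x y) {u v : V} (hx : x ∈ C.L u) (hy : y ∈ C.L v) : u ≠ v := by
  have he : s(x, y) ∈ C.H.edgeSet := h
  rw [C.edges_eq] at he
  obtain ⟨p, q, hpq, -, a, ha, b, hb, hab⟩ := he
  rcases Sym2.eq_iff.1 hab with ⟨rfl, rfl⟩ | ⟨rfl, rfl⟩
  · rw [C.part_unique hx ha, C.part_unique hy hb]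
    exact hpq
  · rw [C.part_unique hx hb, C.part_unique hy ha]
    exact hpq.symm

/-- A transversal is the range of a unique choice of labels. Its independence needs checking only
across distinct parts. -/
theorem numColorings_eq [Fintype V] [DecidableEq V] [Fintype α]
    (C : DPCover (SimpleGraph.completeGraph V) W) (e : ∀ v, α ≃ C.L v) :
    C.numColorings = #(independentLabelings (C.labeledGraph e)) := by
  have hinj : Function.Injective fun (x : V → α) => Set.range fun v => (e v (x v) : W) := by
    intro x y hxy
    ext v
    have : (e v (x v) : W) ∈ Set.range fun v => (e v (y v) : W) := by
      have hxy' : (Set.range fun v => (e v (x v) : W)) = Set.range fun v => (e v (y v) : W) := hxy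
      exact hxy' ▸ ⟨v, rfl⟩
    obtain ⟨w, hw⟩ := this
    have hw : (e w (y w) : W) = e v (x v) := hw
    have hwv : w = v := C.part_unique (e w (y w)).2 (by rw [hw]; exact (e v (x v)).2)
    subst hwv
    exact (e w).injective (Subtype.ext hw.symm)
  rw [numColorings, ← Set.ncard_coe_finset, ← Set.ncard_image_of_injective _ hinj]
  congr 1
  ext T
  constructor
  · rintro ⟨hT, hI⟩
    choose f hf hu using hT
    have hfT : T = Set.range fun v => f v := by
      ext x
      constructor
      · intro hx
        obtain ⟨v, hv⟩ := Set.mem_iUnion.1 (C.iUnion_parts ▸ Set.mem_univ x : x ∈ ⋃ v, C.L v)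
        exact ⟨v, (hu v x ⟨hx, hv⟩).symm⟩
      · rintro ⟨v, rfl⟩
        exact (hf v).1
    refine ⟨fun v => (e v).symm ⟨f v, (hf v).2⟩, ?_, by simp [hfT]⟩
    rw [mem_coe, mem_independentLabelings]
    intro u v huv h
    have h' : C.H.Adj (f u) (f v) := by simpa [labeledGraph] using h
    exact hI (hf u).1 (hf v).1 h'.ne h'
  · rintro ⟨x, hx, rfl⟩
    rw [mem_coe, mem_independentLabelings] at hx
    refine ⟨fun v => ⟨e v (x v), ⟨⟨v, rfl⟩, (e v (x v)).2⟩, ?_⟩, ?_⟩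
    · rintro _ ⟨⟨w, rfl⟩, hw⟩
      have := C.part_unique (e w (x w)).2 hw
      subst this
      rfl
    · rintro _ ⟨u, rfl⟩ _ ⟨v, rfl⟩ hne
      exact hx u v (by rintro rfl; exact hne rfl)

theorem pow_le_triangleLifts_labeledGraph [Fintype V] [DecidableEq V] [Fintype α]
    (C : DPCover (SimpleGraph.completeGraph V) W) (e : ∀ v, α ≃ C.L v)
    (h : ¬ C.H.CliqueFree 3) :
    Fintype.card α ^ (Fintype.card V - 3) ≤ triangleLifts (C.labeledGraph e) := by
  classical
  rw [SimpleGraph.CliqueFree] at h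
  push Not at h
  obtain ⟨T, hT⟩ := h
  obtain ⟨x, y, z, hxy, hxz, hyz, -⟩ := SimpleGraph.is3Clique_iff.1 hT
  have hpart : ∀ x, ∃ v i, (e v i : W) = x := by
    intro x
    obtain ⟨v, hv⟩ := Set.mem_iUnion.1 (C.iUnion_parts ▸ Set.mem_univ x : x ∈ ⋃ v, C.L v)
    exact ⟨v, (e v).symm ⟨x, hv⟩, by simp⟩
  obtain ⟨u, i, rfl⟩ := hpart x
  obtain ⟨v, j, rfl⟩ := hpart y
  obtain ⟨w, k, rfl⟩ := hpart z
  exact pow_le_triangleLifts (C.parts_ne_of_adj hxy (e u i).2 (e v j).2)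
    (C.parts_ne_of_adj hyz (e v j).2 (e w k).2)
    (C.parts_ne_of_adj hxz.symm (e w k).2 (e u i).2) (i := i) (j := j) (k := k)
    hxy hyz hxz.symm

/-- The cover of the complete graph given by a perfectly matched graph on `V × α`. -/
def ofPerfectlyMatched [Nonempty α] (K : SimpleGraph (V × α)) (hK : PerfectlyMatched K)
    (hpart : ∀ p q, K.Adj p q → p.1 ≠ q.1) : DPCover (SimpleGraph.completeGraph V) (V × α) where
  L v := {p | p.1 = v}
  H := K
  nonempty_part v := ⟨(v, Classical.arbitrary α), rfl⟩
  disjoint_parts u v huv := Set.disjoint_left.2 fun p hu hv => huv (hu.symm.trans hv)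
  iUnion_parts := by ext p; simp
  matching u v huv := by
    have huv' : u ≠ v := huv
    rintro e ⟨he, ⟨a, i⟩, rfl, ⟨b, j⟩, rfl, rfl⟩ f ⟨hf, ⟨c, k⟩, hc, ⟨d, l⟩, hd, rfl⟩ x hx hx'
    obtain rfl : c = a := hc
    obtain rfl : d = b := hd
    have he' : K.Adj (c, i) (d, j) := he
    have hf' : K.Adj (c, k) (d, l) := hf
    have h1 : ∀ {l}, K.Adj (c, i) (d, l) → j = l := (hK c d huv' i).unique he'
    have h2 : ∀ {k}, K.Adj (d, j) (c, k) → i = k := (hK d c huv'.symm j).unique he'.symm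
    simp only [Sym2.mem_iff] at hx hx'
    rcases hx with rfl | rfl <;> rcases hx' with h | h <;> simp only [Prod.mk.injEq] at h
    · obtain ⟨-, rfl⟩ := h
      rw [h1 hf']
    · exact (huv' h.1).elim
    · exact (huv' h.1.symm).elim
    · obtain ⟨-, rfl⟩ := h
      rw [h2 hf'.symm]
  edges_eq := by
    ext e
    induction e using Sym2.ind with
    | _ p q =>
      constructor
      · intro h
        exact ⟨p.1, q.1, hpart p q h, h, p, rfl, q, rfl, rfl⟩
      · rintro ⟨u, v, -, h, -⟩
        exact h

theorem ofPerfectlyMatched_isFullFold [Fintype α] [Nonempty α] (K : SimpleGraph (V × α))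
    (hK : PerfectlyMatched K) (hpart : ∀ p q, K.Adj p q → p.1 ≠ q.1) :
    (ofPerfectlyMatched K hK hpart).IsFullFold (Fintype.card α) := by
  constructor
  · intro v
    have : (ofPerfectlyMatched K hK hpart).L v = Set.range (fun i : α => (v, i)) := by
      ext ⟨a, i⟩
      simp [ofPerfectlyMatched, eq_comm]
    rw [this, ← Set.image_univ, Set.ncard_image_of_injective _ (fun i j h => by simpa using h)]
    simp [Set.ncard_univ]
  · intro u v huv
    choose f hf hu using hK u v huv
    have : edgesBetween (ofPerfectlyMatched K hK hpart).H ((ofPerfectlyMatched K hK hpart).L u)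
        ((ofPerfectlyMatched K hK hpart).L v) = Set.range (fun i : α => s((u, i), (v, f i))) := by
      ext e
      constructor
      · rintro ⟨he, ⟨a, i⟩, rfl, ⟨b, j⟩, rfl, rfl⟩
        exact ⟨i, by rw [hu i j he]⟩
      · rintro ⟨i, rfl⟩
        exact ⟨hf i, (u, i), rfl, (v, f i), rfl, rfl⟩
    rw [this, ← Set.image_univ, Set.ncard_image_of_injective]
    · simp [Set.ncard_univ]
    · intro i j h
      have hne : u ≠ v := huv
      have := Sym2.eq_iff.1 h
      rcases this with ⟨h, -⟩ | ⟨h, -⟩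
      · exact (Prod.mk.inj h).2
      · exact (hne (Prod.mk.inj h).1).elim

theorem numColorings_ofPerfectlyMatched [Fintype V] [DecidableEq V] [Fintype α] [Nonempty α]
    (K : SimpleGraph (V × α)) (hK : PerfectlyMatched K)
    (hpart : ∀ p q, K.Adj p q → p.1 ≠ q.1) :
    (ofPerfectlyMatched K hK hpart).numColorings = #(independentLabelings K) := by
  let e : ∀ v, α ≃ (ofPerfectlyMatched K hK hpart).L v := fun v =>
    { toFun := fun i => ⟨(v, i), rfl⟩
      invFun := fun p => p.1.2
      left_inv := fun i => rfl
      right_inv := by rintro ⟨⟨a, i⟩, rfl⟩; rfl }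
  rw [numColorings_eq _ e]
  rfl

theorem exists_labeling [Finite W] {G : SimpleGraph V} (C : DPCover G W) {m : ℕ} (hC : C.IsFold m) :
    Nonempty (∀ v, Fin m ≃ C.L v) :=
  ⟨fun v => (Finite.equivFinOfCardEq (hC v)).symm⟩

end DPColoring.DPCover

end Covers

/-! ### Conclusion for the complete graph -/

theorem theorem2 (n m : ℕ) (hn : 4 ≤ n)
    (hm : (2 : ℤ) ^ (n.choose 2 + 1) + (n.choose 2 : ℤ) + (n : ℤ) - 6 < (m : ℤ)) :
    (∀ (W : Type*) [Finite W] (C : DPColoring.DPCover (SimpleGraph.completeGraph (Fin n)) W),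
      C.IsFullFold m →
      C.numColorings = DPColoring.dualDPColorFunction (SimpleGraph.completeGraph (Fin n)) m →
      C.H.CliqueFree 3) ∧
    DPColoring.mainPart n m - 2 ^ n.choose 2 * (m : ℤ) ^ (n - 4)
      ≤ (DPColoring.dualDPColorFunction (SimpleGraph.completeGraph (Fin n)) m : ℤ) ∧
    (DPColoring.dualDPColorFunction (SimpleGraph.completeGraph (Fin n)) m : ℤ)
      ≤ DPColoring.mainPart n m + 2 ^ n.choose 2 * (m : ℤ) ^ (n - 4) := by
  have hm1 : 2 ^ (n.choose 2 + 1) < m := by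
    -- Since t ≥ 6, the summand t + n - 6 is nonnegative and the hypothesis yields m > 2^(t+1).
    have h6 : (6 : ℤ) ≤ n.choose 2 := by exact_mod_cast six_le_choose_two hn
    have : (2 : ℤ) ^ (n.choose 2 + 1) < m := by
      have : (0 : ℤ) ≤ n := by positivity
      linarith
    exact_mod_cast this
  have hm2 : 2 ^ n.choose 2 ≤ m := by
    rw [pow_succ] at hm1
    omega
  have hm3 : 3 ≤ m := by
    have h64 : 2 ^ 6 ≤ 2 ^ n.choose 2 :=
      Nat.pow_le_pow_right (by norm_num) (six_le_choose_two hn)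
    omega
  have hgreat := DPColoring.isGreatest_dualDPColorFunction
    (SimpleGraph.completeGraph (Fin n)) m (by omega)
  have lower : DPColoring.mainPart n m - 2 ^ n.choose 2 * (m : ℤ) ^ (n - 4)
      ≤ (DPColoring.dualDPColorFunction (SimpleGraph.completeGraph (Fin n)) m : ℤ) := by
    obtain ⟨σ, hσ, hσ2⟩ := exists_perm_almost_involution hm3
    have : Nonempty (Fin m) := ⟨⟨0, by omega⟩⟩
    have hK := twistedGraph_perfectlyMatched (V := Fin n) σ
    have hpart : ∀ p q, (twistedGraph (Fin n) σ).Adj p q → p.1 ≠ q.1 := by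
      rintro p q (h | h)
      · exact h.1.ne
      · exact h.1.ne'
    have hmem : #(independentLabelings (twistedGraph (Fin n) σ)) ∈
        DPColoring.fullFoldValues (SimpleGraph.completeGraph (Fin n)) m :=
      ⟨Fin n × Fin m, inferInstance, DPColoring.DPCover.ofPerfectlyMatched _ hK hpart,
        by simpa using DPColoring.DPCover.ofPerfectlyMatched_isFullFold _ hK hpart,
        DPColoring.DPCover.numColorings_ofPerfectlyMatched _ hK hpart⟩
    have h := le_card_independentLabelings hK (by simpa using hn)
      (by rw [Fintype.card_fin]; omega) (fun A hA => lifts_twistedGraph_triangle hσ hA)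
      (fun A hA => pow_le_card_lifts_twistedGraph_square (by simpa using hn)
        (by rw [Fintype.card_fin]; omega) (by convert hσ2) hA)
    simp only [Fintype.card_fin] at h
    exact h.trans (by exact_mod_cast hgreat.2 hmem)
  refine ⟨?_, lower, ?_⟩
  · intro W _ C hC hmax
    by_contra hT
    obtain ⟨e⟩ := C.exists_labeling hC.1
    -- A triangle would put the maximum strictly below `lower`.
    have h := card_independentLabelings_lt (C.labeledGraph_perfectlyMatched hC e)
      (by simpa using hn) (by simpa using hm1) (C.pow_le_triangleLifts_labeledGraph e hT)
    rw [← C.numColorings_eq e, hmax] at h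
    simp only [Fintype.card_fin] at h
    linarith
  · obtain ⟨W, _, C, hC, hmax⟩ := hgreat.1
    obtain ⟨e⟩ := C.exists_labeling hC.1
    have h := card_independentLabelings_le (C.labeledGraph_perfectlyMatched hC e)
      (by simpa using hn) (by simpa using hm2)
    rw [← C.numColorings_eq e, hmax] at h
    simpa only [Fintype.card_fin] using h
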